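/- Let $X$ and $U$ be (real or complex) Hilbert spaces, let $A : D(A)\subset X\to X$ be such that $-A$ generates a strongly continuous semigroup $(S(t))_{t\ge 0}$ on $X$, let $X_{-1}=D(A^*)'$ (the dual of $D(A^*)$ with respect to the pivot space $X$, so that $X\subset X_{-1}$ and $S$ extends to $X_{-1}$), and let $B\in\mathcal L(U,X_{-1})$ be an admissible control operator: for some $\tau>0$, $\int_0^\tau S(\tau-s)Bu(s)\,ds\in X$ for every $u\in L^2(0,\tau;U)$. For $u\in L^2(a,b;U)$, the solution of $x'+Ax=Bu$ on $[a,b]$ with $x(a)=x_a\in X$ is the function $x\in C([a,b];X)$ with $$x(t)=S(t-a)x_a+\int_a^t S(t-s)Bu(s)\,ds\quad\text{in }X_{-1},\qquad t\in[a,b].$$ Let $0<t_0<T$ and assume that the system is exactly controllable in time $t_0$: there is a constant $C_1>0$ such that for all $x_0,x_1\in X$ there is a control $u\in L^2(0,t_0;U)$ with $\|u\|_{L^2(0,t_0;U)}\le C_1(\|x_0\|_X+\|x_1\|_X)$ for which the solution with $x(0)=x_0$ satisfies $x(t_0)=x_1$. Let $x_0\in X$, and let $x_d\in X$ be holdable with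 the constant control $u_d\in U$: the constant function $x_d$ is the solution on $[t_0,T]$ that starts at $x_d$ at time $t_0$ and has the constant control $u_d$. For $\gamma>0$ let ${\bf R}(T,\gamma)$ be the problem of minimizing $$\tfrac12\|u-u_d\|^2_{L^2(0,T;U)}+\gamma\int_{t_0}^T\frac{1}{s-t_0}\|x(s)-x_d\|_X\,ds\in[0,\infty]$$ over all $u\in L^2(0,T;U)$, where $x\in C([0,T];X)$ is the solution of $x'+Ax=Bu$ on $[0,T]$ with $x(0)=x_0$. Then for every $\gamma>0$ the problem ${\bf R}(T,\gamma)$ has a unique optimal control/state pair $(u_T,x_T)$, and $x_T(t)=x_d$ for all $t\in[t_0,T]$. -/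

import Mathlib

open MeasureTheory Set Filter Topology
open scoped ENNReal NNReal InnerProductSpace

noncomputable section

namespace Turnpike

/-- A strongly continuous semigroup of bounded operators on `X`. -/
structure C0Semigroup (𝕜 X : Type*) [RCLike 𝕜] [NormedAddCommGroup X] [InnerProductSpace 𝕜 X] where
  toFun : ℝ≥0 → X →L[𝕜] X
  map_zero : toFun 0 = ContinuousLinearMap.id 𝕜 X
  map_add : ∀ s t : ℝ≥0, toFun (s + t) = (toFun s).comp (toFun t)
  continuous_orbit : ∀ x : X, Continuous fun t => toFun t x

/-- `G` is the infinitesimal generator of `S`: `x ∈ D(G)` and `G x = y` if and only if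
`(S h x - x) / h → y` as `h ↓ 0`. -/
def C0Semigroup.IsGenerator {𝕜 X : Type*} [RCLike 𝕜] [NormedAddCommGroup X]
    [InnerProductSpace 𝕜 X] (S : C0Semigroup 𝕜 X) (G : X →ₗ.[𝕜] X) : Prop :=
  ∀ x y : X, (x, y) ∈ G.graph ↔
    Tendsto (fun h : ℝ≥0 => (((h : ℝ)⁻¹ : ℝ) : 𝕜) • (S.toFun h x - x)) (𝓝[>] 0) (𝓝 y)

/-- The domain `D(A*)` of the Hilbert space adjoint of `A` with its graph norm, realised as the
graph `{(φ, A* φ)}` of `A*` in `X × X`. -/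
abbrev AdjointDomain {𝕜 X : Type*} [RCLike 𝕜] [NormedAddCommGroup X] [InnerProductSpace 𝕜 X]
    (A : X →ₗ.[𝕜] X) : Submodule 𝕜 (X × X) :=
  A.graph.adjoint

/-- The extrapolation space `X₋₁ = D(A*)'`: the (anti)dual of `D(A*)` with respect to the pivot
space `X`. Functionals are conjugate linear, so that `X` embeds linearly. -/
abbrev Extrapolation {𝕜 X : Type*} [RCLike 𝕜] [NormedAddCommGroup X] [InnerProductSpace 𝕜 X]
    (A : X →ₗ.[𝕜] X) : Type _ :=
  AdjointDomain A →L⋆[𝕜] 𝕜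

/-- The embedding `X → X₋₁`, `x ↦ (φ ↦ ⟪φ, x⟫)`. -/
def embed {𝕜 X : Type*} [RCLike 𝕜] [NormedAddCommGroup X] [InnerProductSpace 𝕜 X]
    (A : X →ₗ.[𝕜] X) (x : X) : Extrapolation A :=
  ((innerSL 𝕜).flip x).comp
    ((ContinuousLinearMap.fst 𝕜 X X).comp (AdjointDomain A).subtypeL)

theorem embed_apply {𝕜 X : Type*} [RCLike 𝕜] [NormedAddCommGroup X] [InnerProductSpace 𝕜 X]
    (A : X →ₗ.[𝕜] X) (x : X) (φ : AdjointDomain A) :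
    embed A x φ = ⟪(φ : X × X).1, x⟫_𝕜 := rfl

/-- The data of a linear control system `x' + A x = B u` on the Hilbert space `X` with controls in
the Hilbert space `U`: `-A` generates the strongly continuous semigroup `S`, and the control
operator `B` is a bounded operator from `U` to the extrapolation space `X₋₁`. -/
structure ControlSystem (𝕜 X U : Type*) [RCLike 𝕜] [NormedAddCommGroup X]
    [InnerProductSpace 𝕜 X] [NormedAddCommGroup U] [InnerProductSpace 𝕜 U] where
  A : X →ₗ.[𝕜] X
  S : C0Semigroup 𝕜 X
  isGenerator : S.IsGenerator (-A)
  B : U →L[𝕜] Extrapolation A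

/-- The Hilbert space `L²(a, b; U)`. -/
abbrev L2 (a b : ℝ) (U : Type*) [NormedAddCommGroup U] : Type _ :=
  Lp U 2 (volume.restrict (Ioo a b))

namespace ControlSystem

variable {𝕜 X U : Type*} [RCLike 𝕜] [NormedAddCommGroup X] [InnerProductSpace 𝕜 X]
  [NormedAddCommGroup U] [InnerProductSpace 𝕜 U]

/-- The semigroup leaves `D(A)` invariant and commutes with `A` there. -/
theorem semigroup_mem_graph (sys : ControlSystem 𝕜 X U) (t : ℝ≥0) {x y : X}
    (h : (x, y) ∈ sys.A.graph) : (sys.S.toFun t x, sys.S.toFun t y) ∈ sys.A.graph := by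
  have key : ∀ a b : X, (a, b) ∈ sys.A.graph ↔ (a, -b) ∈ (-sys.A).graph := by
    intro a b
    simp only [LinearPMap.mem_graph_iff, LinearPMap.neg_apply]
    constructor
    · rintro ⟨z, rfl, rfl⟩
      exact ⟨z, rfl, rfl⟩
    · rintro ⟨z, rfl, hz⟩
      exact ⟨z, rfl, neg_injective hz⟩
  rw [key] at h ⊢
  have h1 := (sys.isGenerator _ _).1 h
  refine (sys.isGenerator _ _).2 ?_
  have h2 := ((sys.S.toFun t).continuous.tendsto _).comp h1
  rw [ContinuousLinearMap.map_neg] at h2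
  refine h2.congr fun r => ?_
  have h3 : sys.S.toFun t (sys.S.toFun r x) = sys.S.toFun r (sys.S.toFun t x) := by
    rw [← ContinuousLinearMap.comp_apply, ← ContinuousLinearMap.comp_apply, ← sys.S.map_add,
      ← sys.S.map_add, add_comm]
  simp only [Function.comp_apply, map_smul, map_sub, h3]

variable [CompleteSpace X]

/-- The adjoint semigroup leaves `D(A*)` invariant and commutes with `A*` there. -/
theorem adjoint_mem (sys : ControlSystem 𝕜 X U) (t : ℝ≥0) {p : X × X}
    (hp : p ∈ AdjointDomain sys.A) :
    ((sys.S.toFun t).adjoint.prodMap (sys.S.toFun t).adjoint) p ∈ AdjointDomain sys.A := by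
  rw [Submodule.mem_adjoint_iff] at hp ⊢
  intro a b hab
  have h := hp _ _ (sys.semigroup_mem_graph t hab)
  simpa [ContinuousLinearMap.adjoint_inner_right] using h

/-- The restriction of the adjoint semigroup to `D(A*)`. -/
def adjointSemigroup (sys : ControlSystem 𝕜 X U) (t : ℝ≥0) :
    AdjointDomain sys.A →L[𝕜] AdjointDomain sys.A :=
  (((sys.S.toFun t).adjoint.prodMap (sys.S.toFun t).adjoint).comp
    (AdjointDomain sys.A).subtypeL).codRestrict (AdjointDomain sys.A)
    fun p => sys.adjoint_mem t p.2

/-- The extension of the semigroup from `X` to `X₋₁`: `⟨φ, S₋₁(t) ξ⟩ = ⟨S(t)* φ, ξ⟩`. -/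
def extendedSemigroup (sys : ControlSystem 𝕜 X U) (t : ℝ≥0) (ξ : Extrapolation sys.A) :
    Extrapolation sys.A :=
  ξ.comp (sys.adjointSemigroup t)

/-- `S₋₁(t)` extends `S(t)`. -/
theorem extendedSemigroup_embed (sys : ControlSystem 𝕜 X U) (t : ℝ≥0) (x : X) :
    sys.extendedSemigroup t (embed sys.A x) = embed sys.A (sys.S.toFun t x) := by
  ext φ
  exact ContinuousLinearMap.adjoint_inner_left (sys.S.toFun t) x (φ : X × X).1

/-- The input map `∫ₐᵗ S₋₁(t - s) B u(s) ds`, an integral in `X₋₁`. -/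
def inputMap (sys : ControlSystem 𝕜 X U) (a t : ℝ) (u : ℝ → U) : Extrapolation sys.A :=
  ∫ s in Ioo a t, sys.extendedSemigroup (t - s).toNNReal (sys.B (u s))

/-- `B` is an admissible control operator: for some `τ > 0` the input map sends `L²(0, τ; U)`
into `X`. -/
def IsAdmissible (sys : ControlSystem 𝕜 X U) : Prop :=
  ∃ τ : ℝ, 0 < τ ∧ ∀ u : L2 0 τ U, ∃ x : X, embed sys.A x = sys.inputMap 0 τ u

/-- `x ∈ C([a, b]; X)` is the (mild) solution of `x' + A x = B u` on `[a, b]` with `x(a) = xₐ`. -/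
def IsSolution (sys : ControlSystem 𝕜 X U) (a b : ℝ) (xa : X) (u : L2 a b U) (x : ℝ → X) : Prop :=
  ContinuousOn x (Icc a b) ∧
    ∀ t ∈ Icc a b, embed sys.A (x t) =
      embed sys.A (sys.S.toFun (t - a).toNNReal xa) + sys.inputMap a t u

/-- Exact controllability in time `t₀` using `L²`-controls, with controls bounded by the data. -/
def IsExactlyControllable (sys : ControlSystem 𝕜 X U) (t₀ : ℝ) : Prop :=
  ∃ C : ℝ, 0 < C ∧ ∀ x₀ x₁ : X, ∃ (u : L2 0 t₀ U) (x : ℝ → X),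
    sys.IsSolution 0 t₀ x₀ u x ∧ x t₀ = x₁ ∧ ‖u‖ ≤ C * (‖x₀‖ + ‖x₁‖)

/-- `xd` is holdable on `[t₀, T]` with the constant control `ud`: started at `xd` at time `t₀`, the
constant control `ud` keeps the state at `xd` on `[t₀, T]`. -/
def IsHoldable (sys : ControlSystem 𝕜 X U) (t₀ T : ℝ) (xd : X) (ud : U) : Prop :=
  sys.IsSolution t₀ T xd (Lp.const 2 _ ud) fun _ => xd

end ControlSystem

/-- The cost `½ ‖u - ud‖² + γ ∫_{t₀}^T ‖x(s) - xd‖ / (s - t₀) ds`, with values in `[0, ∞]`. -/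
def cost {X U : Type*} [NormedAddCommGroup X] [NormedAddCommGroup U] (t₀ T γ : ℝ) (xd : X) (ud : U)
    (u : L2 0 T U) (x : ℝ → X) : ℝ≥0∞ :=
  ENNReal.ofReal (1 / 2 * ‖u - Lp.const 2 _ ud‖ ^ 2) +
    ENNReal.ofReal γ * ∫⁻ s in Ioo t₀ T, ENNReal.ofReal (1 / (s - t₀) * ‖x s - xd‖)

/-- `(u, x)` is an optimal control/state pair of the problem of minimising `cost` over all
`u ∈ L²(0, T; U)`, where `x` is the state generated by `u` from the initial state `x₀`. -/
def IsOptimal {𝕜 X U : Type*} [RCLike 𝕜] [NormedAddCommGroup X] [InnerProductSpace 𝕜 X]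
    [CompleteSpace X] [NormedAddCommGroup U] [InnerProductSpace 𝕜 U]
    (sys : ControlSystem 𝕜 X U) (t₀ T γ : ℝ) (x₀ xd : X) (ud : U)
    (u : L2 0 T U) (x : ℝ → X) : Prop :=
  sys.IsSolution 0 T x₀ u x ∧
    ∀ (v : L2 0 T U) (y : ℝ → X), sys.IsSolution 0 T x₀ v y →
      cost t₀ T γ xd ud u x ≤ cost t₀ T γ xd ud v y

end Turnpike

end

noncomputable section

namespace Turnpike

/-! ### Strongly continuous semigroups and their weak orbits. -/

section Semigroup

variable {𝕜 X : Type*} [RCLike 𝕜] [NormedAddCommGroup X] [InnerProductSpace 𝕜 X]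

/-! The weight `1 / (s - t₀)` is not integrable at `t₀`, so a continuous state has finite cost only
if `x t₀ = xd` (`lintegral_weight_eq_top`). Hitting `xd` at time `t₀` is an affine condition `Φ u =
e`, where `Φ` is the bounded input map at time `t₀` into `X₋₁`; it can be met by exact
controllability. Its solution set in `L²` is closed, affine and nonempty, so it has a point `u`
nearest to the constant `ud`, with Pythagoras' identity (`exists_nearest_of_affine`).

Since `Φ` sees the control only on `(0, t₀)`, replacing `u` by `ud` after `t₀` keeps it feasible and
no farther from `ud`. By uniqueness `u = ud` there, and holdability keeps the state at `xd`. The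
integral term therefore vanishes, and the pair costs `½ ‖u - ud‖²`. Every competitor of finite cost
is feasible, so it costs at least this much, with equality only for `u`.

The functional analysis supplies two facts. The space `X` embeds injectively into `X₋₁`
(`embed_injective`), so states are determined by their equation there. Every `L²` control has a
state continuous in `X` (`exists_isSolution`): admissibility propagates from one time to all times,
the closed graph theorem makes the input map bounded into `X`, and translations are strongly
continuous on `L²`. -/

theorem C0Semigroup.toFun_add_apply (S : C0Semigroup 𝕜 X) (s t : ℝ≥0) (x : X) :
    S.toFun (s + t) x = S.toFun s (S.toFun t x) := by
  rw [S.map_add]; rfl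

/-- The operator norms of a strongly continuous semigroup are locally bounded. -/
theorem C0Semigroup.exists_norm_le [CompleteSpace X] (S : C0Semigroup 𝕜 X) (σ : ℝ≥0) :
    ∃ M : ℝ, 0 ≤ M ∧ ∀ t ≤ σ, ‖S.toFun t‖ ≤ M := by
  have h : ∀ x, ∃ C, ∀ t : Icc 0 σ, ‖S.toFun t x‖ ≤ C := by
    intro x
    obtain ⟨C, hC⟩ := (isCompact_Icc (a := (0 : ℝ≥0)) (b := σ)).exists_bound_of_continuousOn
      (S.continuous_orbit x).continuousOn
    exact ⟨C, fun t => hC t t.2⟩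
  obtain ⟨M, hM⟩ := banach_steinhaus h
  exact ⟨M, (norm_nonneg _).trans (hM ⟨0, by simp⟩), fun t ht => hM ⟨t, by simpa using ht⟩⟩

theorem C0Semigroup.continuous_inner_orbit (S : C0Semigroup 𝕜 X) (ψ x : X) :
    Continuous fun s : ℝ => ⟪ψ, S.toFun s.toNNReal x⟫_𝕜 :=
  continuous_const.inner ((S.continuous_orbit x).comp continuous_real_toNNReal)

/-- The time average of the orbits of the adjoint semigroup, as a weak integral. -/
theorem C0Semigroup.exists_inner_eq_integral [CompleteSpace X] (S : C0Semigroup 𝕜 X) (ψ : X)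
    {h : ℝ} (hh : 0 ≤ h) :
    ∃ m : X, ∀ x, ⟪m, x⟫_𝕜 = ∫ s in (0 : ℝ)..h, ⟪ψ, S.toFun s.toNNReal x⟫_𝕜 := by
  obtain ⟨M, hM0, hM⟩ := S.exists_norm_le h.toNNReal
  have hint : ∀ x, IntervalIntegrable (fun s : ℝ => ⟪ψ, S.toFun s.toNNReal x⟫_𝕜) volume 0 h :=
    fun x => (S.continuous_inner_orbit ψ x).intervalIntegrable _ _
  let f : X →ₗ[𝕜] 𝕜 :=
    { toFun := fun x => ∫ s in (0 : ℝ)..h, ⟪ψ, S.toFun s.toNNReal x⟫_𝕜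
      map_add' := fun x y => by
        rw [← intervalIntegral.integral_add (hint x) (hint y)]
        simp only [_root_.map_add, inner_add_right]
      map_smul' := fun c x => by
        rw [RingHom.id_apply, smul_eq_mul, ← intervalIntegral.integral_const_mul]
        simp only [map_smul, inner_smul_right] }
  let g : StrongDual 𝕜 X := f.mkContinuous (‖ψ‖ * M * |h - 0|) fun x => by
    have := intervalIntegral.norm_integral_le_of_norm_le_const (a := 0) (b := h)
      (f := fun s : ℝ => ⟪ψ, S.toFun s.toNNReal x⟫_𝕜) (C := ‖ψ‖ * (M * ‖x‖)) fun s hs => by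
        rw [uIoc_of_le hh] at hs
        refine (norm_inner_le_norm _ _).trans ?_
        gcongr
        exact (S.toFun _).le_of_opNorm_le (hM _ (Real.toNNReal_le_toNNReal hs.2)) x
    calc ‖f x‖ ≤ ‖ψ‖ * (M * ‖x‖) * |h - 0| := this
      _ = _ := by ring
  refine ⟨(InnerProductSpace.toDual 𝕜 X).symm g, fun x => ?_⟩
  rw [InnerProductSpace.toDual_symm_apply]
  rfl

/-- The difference quotient of the orbit of `a` at `s` is `S(s)` applied to the quotient at `0`, so
its right derivative is `S(s) b`. For a continuous function, right derivatives suffice in the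
fundamental theorem of calculus. -/
theorem C0Semigroup.integral_inner_generator (S : C0Semigroup 𝕜 X) {G : X →ₗ.[𝕜] X}
    (hG : S.IsGenerator G) (ψ : X) {a b : X} (hab : (a, b) ∈ G.graph) {h : ℝ} (hh : 0 ≤ h) :
    ∫ s in (0 : ℝ)..h, ⟪ψ, S.toFun s.toNNReal b⟫_𝕜 =
      ⟪ψ, S.toFun h.toNNReal a⟫_𝕜 - ⟪ψ, a⟫_𝕜 := by
  have h0 : ⟪ψ, a⟫_𝕜 = ⟪ψ, S.toFun (0 : ℝ).toNNReal a⟫_𝕜 := by simp [S.map_zero]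
  rw [h0]
  refine intervalIntegral.integral_eq_sub_of_hasDeriv_right_of_le hh
    (f := fun s : ℝ => ⟪ψ, S.toFun s.toNNReal a⟫_𝕜)
    (S.continuous_inner_orbit ψ a).continuousOn (fun s hs => ?_)
    ((S.continuous_inner_orbit ψ b).intervalIntegrable _ _)
  rw [hasDerivWithinAt_iff_tendsto_slope' (by simp)]
  have h1 : Tendsto (fun y : ℝ => (y - s).toNNReal) (𝓝[>] s) (𝓝[>] 0) := by
    refine tendsto_nhdsWithin_iff.2 ⟨?_, ?_⟩
    · have : Continuous fun y : ℝ => (y - s).toNNReal := by fun_prop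
      simpa using (this.tendsto s).mono_left nhdsWithin_le_nhds
    · filter_upwards [self_mem_nhdsWithin] with y hy
      simpa using hy
  have h2 := ((hG a b).1 hab).comp h1
  have h3 : Continuous fun z : X => ⟪ψ, S.toFun s.toNNReal z⟫_𝕜 :=
    continuous_const.inner (S.toFun _).continuous
  refine ((h3.tendsto b).comp h2).congr' ?_
  filter_upwards [self_mem_nhdsWithin] with y hy
  have hy' : 0 ≤ y - s := sub_nonneg.2 (le_of_lt hy)
  have h4 : y.toNNReal = s.toNNReal + (y - s).toNNReal := by
    rw [← Real.toNNReal_add hs.1.le hy']; simp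
  simp only [Function.comp_apply, slope, vsub_eq_sub, h4, S.toFun_add_apply, map_smul, map_sub,
    inner_smul_right, inner_sub_right, Real.coe_toNNReal _ hy', RCLike.real_smul_eq_coe_mul]

end Semigroup

theorem continuous_of_norm_sub_le {α E X : Type*} [TopologicalSpace α] [NormedAddCommGroup E]
    [NormedAddCommGroup X] {f : α → E} {g h : α → X} (hg : Continuous g) (hh : Continuous h)
    (hf : ∀ t s, ‖f t - f s‖ ≤ ‖g t - g s‖ + ‖h t - h s‖) : Continuous f := by
  rw [continuous_iff_continuousAt]
  intro s
  have : Continuous fun t => ‖g t - g s‖ + ‖h t - h s‖ := by fun_prop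
  exact tendsto_iff_norm_sub_tendsto_zero.2
    (squeeze_zero (fun _ => norm_nonneg _) (fun t => hf t s) (by simpa using this.tendsto s))

theorem continuous_uncurry_of_locally_bounded {𝕜 E : Type*} [NontriviallyNormedField 𝕜]
    [NormedAddCommGroup E] [NormedSpace 𝕜 E] (L : ℝ≥0 → E →L[𝕜] E)
    (hL : ∀ ξ, Continuous fun t => L t ξ) (hbd : ∀ σ, ∃ M : ℝ, 0 ≤ M ∧ ∀ t ≤ σ, ‖L t‖ ≤ M) :
    Continuous fun p : ℝ≥0 × E => L p.1 p.2 := by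
  rw [continuous_iff_continuousAt]
  rintro ⟨t₀, ξ₀⟩
  obtain ⟨M, hM0, hM⟩ := hbd (t₀ + 1)
  have hlim : Tendsto (fun p : ℝ≥0 × E => M * ‖p.2 - ξ₀‖ + ‖L p.1 ξ₀ - L t₀ ξ₀‖)
      (𝓝 (t₀, ξ₀)) (𝓝 0) := by
    have : Continuous fun p : ℝ≥0 × E => M * ‖p.2 - ξ₀‖ + ‖L p.1 ξ₀ - L t₀ ξ₀‖ :=
      (continuous_const.mul (continuous_snd.sub continuous_const).norm).add
        (((hL ξ₀).comp continuous_fst).sub continuous_const).norm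
    simpa using this.tendsto (t₀, ξ₀)
  refine tendsto_iff_norm_sub_tendsto_zero.2
    (squeeze_zero' (Eventually.of_forall fun _ => norm_nonneg _) ?_ hlim)
  have hev : ∀ᶠ p : ℝ≥0 × E in 𝓝 (t₀, ξ₀), p.1 < t₀ + 1 :=
    continuous_fst.continuousAt.eventually_lt continuousAt_const (by simp)
  filter_upwards [hev] with p hp
  have h1 : L p.1 p.2 - L t₀ ξ₀ = L p.1 (p.2 - ξ₀) + (L p.1 ξ₀ - L t₀ ξ₀) := by
    rw [map_sub]
    abel
  rw [h1]
  exact norm_add_le_of_le ((L p.1).le_of_opNorm_le (hM _ hp.le) _) le_rfl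

/-- Bounded operators between normed spaces. -/
abbrev BoundedOperator (𝕜 F E : Type*) [NontriviallyNormedField 𝕜] [NormedAddCommGroup F]
    [NormedSpace 𝕜 F] [NormedAddCommGroup E] [NormedSpace 𝕜 E] : Type _ := F →L[𝕜] E

/-! ### The extrapolation space and the extended semigroup. -/

namespace ControlSystem

variable {𝕜 X U : Type*} [RCLike 𝕜] [NormedAddCommGroup X] [InnerProductSpace 𝕜 X]
  [NormedAddCommGroup U] [InnerProductSpace 𝕜 U] [CompleteSpace X]

/-- The domain of `A*` separates the points of `X`, so `X` embeds into `X₋₁`. -/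
theorem embed_injective (sys : ControlSystem 𝕜 X U) : Function.Injective (embed sys.A) := by
  have key : ∀ x, embed sys.A x = 0 → x = 0 := by
    intro x hx
    -- The vector `m = ∫₀ʰ S(s)* x ds` lies in `D(A*)`, with `A* m = x - S(h)* x`, so `embed x = 0`
    -- kills `⟪m, x⟫`. Differentiating in `h` at `0` then gives `⟪x, x⟫ = 0`.
    have hzero : ∀ h : ℝ, 0 ≤ h → ∫ s in (0 : ℝ)..h, ⟪x, sys.S.toFun s.toNNReal x⟫_𝕜 = 0 := by
      intro h hh
      obtain ⟨m, hm⟩ := sys.S.exists_inner_eq_integral x hh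
      have hmem : (m, x - (sys.S.toFun h.toNNReal).adjoint x) ∈ AdjointDomain sys.A := by
        rw [Submodule.mem_adjoint_iff]
        intro a b hab
        have hab' : (a, -b) ∈ (-sys.A).graph := by
          rw [LinearPMap.mem_graph_iff] at hab ⊢
          obtain ⟨z, rfl, rfl⟩ := hab
          exact ⟨z, rfl, rfl⟩
        have h1 := sys.S.integral_inner_generator sys.isGenerator x hab' hh
        rw [← hm, inner_neg_right] at h1
        have h2 := congrArg (starRingEnd 𝕜) h1
        simp only [map_neg, map_sub, inner_conj_symm] at h2
        rw [inner_sub_right, ContinuousLinearMap.adjoint_inner_right]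
        linear_combination -h2
      rw [← hm]
      exact DFunLike.congr_fun hx ⟨_, hmem⟩
    have hd := ((sys.S.continuous_inner_orbit x x).integral_hasStrictDerivAt 0 0).hasDerivAt
    have h1 := hd.hasDerivWithinAt (s := Ici 0)
    have h2 : HasDerivWithinAt (fun h : ℝ => ∫ s in (0 : ℝ)..h, ⟪x, sys.S.toFun s.toNNReal x⟫_𝕜)
        0 (Ici 0) 0 :=
      (hasDerivWithinAt_const (0 : ℝ) (Ici 0) (0 : 𝕜)).congr (fun h hh => hzero h hh)
        (hzero 0 le_rfl)
    have h3 := (uniqueDiffWithinAt_Ici (0 : ℝ)).eq_deriv _ h1 h2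
    simpa [sys.S.map_zero] using h3
  intro x y hxy
  have : embed sys.A (x - y) = 0 := by
    ext φ
    have := DFunLike.congr_fun hxy φ
    simp only [embed_apply] at this
    simp [embed_apply, inner_sub_right, this]
  exact sub_eq_zero.1 (key _ this)

/-- Functionals on `D(A*)` are represented by pairs of vectors. -/
theorem exists_representation (A : X →ₗ.[𝕜] X) (ξ : Extrapolation A) :
    ∃ x y : X, ∀ φ : AdjointDomain A,
      ξ φ = ⟪(φ : X × X).1, x⟫_𝕜 + ⟪(φ : X × X).2, y⟫_𝕜 := by
  -- Conjugation makes `ξ` linear; Hahn–Banach extends it to `X × X`, and Riesz represents each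
  -- component.
  let f : StrongDual 𝕜 (AdjointDomain A) :=
    { toFun := fun φ => starRingEnd 𝕜 (ξ φ)
      map_add' := by simp
      map_smul' := by simp
      cont := RCLike.continuous_conj.comp ξ.continuous }
  obtain ⟨g, hg, -⟩ := exists_extension_norm_eq (AdjointDomain A) f
  refine ⟨(InnerProductSpace.toDual 𝕜 X).symm (g.comp (ContinuousLinearMap.inl 𝕜 X X)),
    (InnerProductSpace.toDual 𝕜 X).symm (g.comp (ContinuousLinearMap.inr 𝕜 X X)), fun φ => ?_⟩
  rw [← inner_conj_symm, ← inner_conj_symm (φ : X × X).2, InnerProductSpace.toDual_symm_apply,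
    InnerProductSpace.toDual_symm_apply, ← map_add]
  have h1 : g.comp (ContinuousLinearMap.inl 𝕜 X X) (φ : X × X).1 +
      g.comp (ContinuousLinearMap.inr 𝕜 X X) (φ : X × X).2 = f φ := by
    rw [← hg φ]
    simp [← map_add]
  rw [h1]
  simp [f]

variable (sys : ControlSystem 𝕜 X U)

theorem extendedSemigroup_apply (t : ℝ≥0) (ξ : Extrapolation sys.A) (φ : AdjointDomain sys.A) :
    sys.extendedSemigroup t ξ φ = ξ (sys.adjointSemigroup t φ) := rfl

theorem adjointSemigroup_coe (t : ℝ≥0) (φ : AdjointDomain sys.A) :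
    (sys.adjointSemigroup t φ : X × X) =
      ((sys.S.toFun t).adjoint (φ : X × X).1, (sys.S.toFun t).adjoint (φ : X × X).2) := rfl

theorem norm_adjointSemigroup_le (t : ℝ≥0) : ‖sys.adjointSemigroup t‖ ≤ ‖sys.S.toFun t‖ := by
  refine ContinuousLinearMap.opNorm_le_bound _ (norm_nonneg _) fun φ => ?_
  change ‖((sys.S.toFun t).adjoint (φ : X × X).1, (sys.S.toFun t).adjoint (φ : X × X).2)‖ ≤ _
  rw [Prod.norm_mk]
  have h := fun z : X => ((sys.S.toFun t).adjoint).le_of_opNorm_le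
    (LinearIsometryEquiv.norm_map ContinuousLinearMap.adjoint (sys.S.toFun t)).le z
  refine max_le ((h _).trans ?_) ((h _).trans ?_) <;> gcongr
  · exact norm_fst_le (φ : X × X)
  · exact norm_snd_le (φ : X × X)

theorem norm_extendedSemigroup_le (t : ℝ≥0) (ξ : Extrapolation sys.A) :
    ‖sys.extendedSemigroup t ξ‖ ≤ ‖sys.S.toFun t‖ * ‖ξ‖ := by
  refine (ContinuousLinearMap.opNorm_comp_le _ _).trans ?_
  rw [mul_comm]
  gcongr
  exact sys.norm_adjointSemigroup_le t

/-- The extended semigroup as a family of bounded operators on `X₋₁`. -/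
def extendedSemigroupL (t : ℝ≥0) :
    BoundedOperator 𝕜 (Extrapolation sys.A) (Extrapolation sys.A) :=
  LinearMap.mkContinuous
    { toFun := sys.extendedSemigroup t
      map_add' := fun _ _ => rfl
      map_smul' := fun _ _ => rfl } ‖sys.S.toFun t‖ (sys.norm_extendedSemigroup_le t)

theorem extendedSemigroupL_apply (t : ℝ≥0) (ξ : Extrapolation sys.A) :
    sys.extendedSemigroupL t ξ = sys.extendedSemigroup t ξ := rfl

theorem extendedSemigroup_add (s t : ℝ≥0) (ξ : Extrapolation sys.A) :
    sys.extendedSemigroup (s + t) ξ = sys.extendedSemigroup s (sys.extendedSemigroup t ξ) := by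
  ext φ
  simp only [extendedSemigroup_apply]
  congr 1
  apply Subtype.ext
  simp only [adjointSemigroup_coe]
  rw [sys.S.map_add, ContinuousLinearMap.adjoint_comp]
  simp

/-- If `(x, y)` represents `ξ`, then `(S(t) x, S(t) y)` represents `S₋₁(t) ξ`. Strong continuity on
`X₋₁` is thus inherited from two orbits in `X`. -/
theorem exists_norm_extendedSemigroup_sub_le (ξ : Extrapolation sys.A) :
    ∃ x y : X, ∀ t s : ℝ≥0, ‖sys.extendedSemigroup t ξ - sys.extendedSemigroup s ξ‖ ≤
      ‖sys.S.toFun t x - sys.S.toFun s x‖ + ‖sys.S.toFun t y - sys.S.toFun s y‖ := by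
  obtain ⟨x, y, hξ⟩ := exists_representation sys.A ξ
  refine ⟨x, y, fun t s => ContinuousLinearMap.opNorm_le_bound _ (by positivity) fun φ => ?_⟩
  have h1 : (sys.extendedSemigroup t ξ - sys.extendedSemigroup s ξ) φ =
      ⟪(φ : X × X).1, sys.S.toFun t x - sys.S.toFun s x⟫_𝕜 +
        ⟪(φ : X × X).2, sys.S.toFun t y - sys.S.toFun s y⟫_𝕜 := by
    change sys.extendedSemigroup t ξ φ - sys.extendedSemigroup s ξ φ = _
    simp only [extendedSemigroup_apply, hξ, adjointSemigroup_coe,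
      ContinuousLinearMap.adjoint_inner_left, inner_sub_right]
    ring
  rw [h1, add_mul]
  refine norm_add_le_of_le ((norm_inner_le_norm _ _).trans ?_) ((norm_inner_le_norm _ _).trans ?_)
  · rw [mul_comm]; gcongr; exact norm_fst_le (φ : X × X)
  · rw [mul_comm]; gcongr; exact norm_snd_le (φ : X × X)

/-- The extended semigroup is strongly continuous on `X₋₁`. -/
theorem continuous_extendedSemigroup (ξ : Extrapolation sys.A) :
    Continuous fun t => sys.extendedSemigroup t ξ := by
  obtain ⟨x, y, h⟩ := sys.exists_norm_extendedSemigroup_sub_le ξ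
  exact continuous_of_norm_sub_le (E := Extrapolation sys.A) (sys.S.continuous_orbit x)
    (sys.S.continuous_orbit y) h

/-- The extended semigroup is jointly continuous. -/
theorem continuous_extendedSemigroup_uncurry :
    Continuous fun p : ℝ≥0 × Extrapolation sys.A => sys.extendedSemigroup p.1 p.2 := by
  refine continuous_uncurry_of_locally_bounded (𝕜 := 𝕜) (E := Extrapolation sys.A)
    sys.extendedSemigroupL sys.continuous_extendedSemigroup fun σ => ?_
  obtain ⟨M, hM0, hM⟩ := sys.S.exists_norm_le σ
  exact ⟨M, hM0, fun t ht => ContinuousLinearMap.opNorm_le_bound _ hM0 fun ξ =>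
    (sys.norm_extendedSemigroup_le t ξ).trans (by gcongr; exact hM t ht)⟩

end ControlSystem

/-! ### Integration of `L²` controls against operator kernels. -/

section Kernel

variable {𝕜 U E : Type*} [RCLike 𝕜] [NormedAddCommGroup U] [NormedSpace 𝕜 U]
  [NormedAddCommGroup E] [NormedSpace 𝕜 E]

theorem integrableOn_kernel {K : ℝ → U →L[𝕜] E}
    (hK : Continuous fun p : ℝ × U => K p.1 p.2) {a b M : ℝ} (hM : ∀ s ∈ Ioo a b, ‖K s‖ ≤ M)
    {u : ℝ → U} (hu : MemLp u 2 (volume.restrict (Ioo a b))) :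
    IntegrableOn (fun s => K s (u s)) (Ioo a b) := by
  have h1 : Integrable u (volume.restrict (Ioo a b)) := hu.integrable (by norm_num)
  refine (h1.norm.const_mul M).mono'
    (hK.comp_aestronglyMeasurable (aestronglyMeasurable_id.prodMk hu.1)) ?_
  filter_upwards [ae_restrict_mem measurableSet_Ioo] with s hs
  exact (K s).le_of_opNorm_le (hM s hs) _

variable [NormedSpace ℝ E] [SMulCommClass ℝ 𝕜 E]

/-- Integration against a bounded strongly continuous kernel is a bounded operator on `L²`. -/
theorem exists_integral_kernel {K : ℝ → U →L[𝕜] E}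
    (hK : Continuous fun p : ℝ × U => K p.1 p.2) {a b M : ℝ} (hM : ∀ s ∈ Ioo a b, ‖K s‖ ≤ M)
    {μ : Measure ℝ} (hμ : volume.restrict (Ioo a b) ≤ μ) :
    ∃ Φ : Lp U 2 μ →L[𝕜] E, ∀ u, Φ u = ∫ s in Ioo a b, K s (u s) := by
  have hint : ∀ u : Lp U 2 μ, IntegrableOn (fun s => K s (u s)) (Ioo a b) := fun u =>
    integrableOn_kernel hK hM ((Lp.memLp u).mono_measure hμ)
  have hae : ∀ {f g : ℝ → U}, f =ᵐ[μ] g → f =ᵐ[volume.restrict (Ioo a b)] g := fun h =>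
    (Measure.absolutelyContinuous_of_le hμ).ae_le h
  let f : Lp U 2 μ →ₗ[𝕜] E :=
    { toFun := fun u => ∫ s in Ioo a b, K s (u s)
      map_add' := fun u v => by
        rw [← integral_add (hint u) (hint v)]
        refine integral_congr_ae ?_
        filter_upwards [hae (Lp.coeFn_add u v)] with s hs
        rw [hs, Pi.add_apply, map_add]
      map_smul' := fun c u => by
        rw [RingHom.id_apply, ← integral_smul]
        refine integral_congr_ae ?_
        filter_upwards [hae (Lp.coeFn_smul c u)] with s hs
        rw [hs, Pi.smul_apply, map_smul] }
  -- The Hölder constant of the inclusion of `L²` into `L¹` on the bounded interval.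
  set C : ℝ≥0∞ := volume.restrict (Ioo a b) univ ^ (1 / (1 : ℝ≥0∞).toReal - 1 / (2 : ℝ≥0∞).toReal)
    with hC
  have hCtop : C ≠ ∞ := by
    refine ENNReal.rpow_ne_top_of_nonneg (by norm_num) (by simp)
  refine ⟨f.mkContinuous ((ENNReal.ofReal M * C).toReal) fun u => ?_, fun u => rfl⟩
  have h1 : ‖f u‖ₑ ≤ ENNReal.ofReal M * C * ‖u‖ₑ := by
    calc ‖f u‖ₑ ≤ ∫⁻ s in Ioo a b, ‖K s (u s)‖ₑ := enorm_integral_le_lintegral_enorm _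
      _ ≤ ∫⁻ s in Ioo a b, ENNReal.ofReal M * ‖u s‖ₑ := by
          refine setLIntegral_mono' measurableSet_Ioo fun s hs => ?_
          rw [← ofReal_norm, ← ofReal_norm, ← ENNReal.ofReal_mul ((norm_nonneg _).trans (hM s hs))]
          exact ENNReal.ofReal_le_ofReal ((K s).le_of_opNorm_le (hM s hs) _)
      _ = ENNReal.ofReal M * eLpNorm u 1 (volume.restrict (Ioo a b)) := by
          rw [lintegral_const_mul' _ _ ENNReal.ofReal_ne_top, eLpNorm_one_eq_lintegral_enorm]
      _ ≤ ENNReal.ofReal M * (eLpNorm u 2 (volume.restrict (Ioo a b)) * C) := by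
          gcongr
          exact eLpNorm_le_eLpNorm_mul_rpow_measure_univ (by norm_num)
            ((Lp.memLp u).mono_measure hμ).1
      _ ≤ ENNReal.ofReal M * (eLpNorm u 2 μ * C) := by
          gcongr
      _ = _ := by rw [Lp.enorm_def]; ring
  have h2 := ENNReal.toReal_mono (by finiteness) h1
  rwa [ENNReal.toReal_mul, toReal_enorm, toReal_enorm] at h2

end Kernel

/-! ### Admissibility: propagation in time and continuity of the input map. -/

/-- A bounded operator whose values lie in the range of an injective bounded operator factors
through it. -/
theorem exists_factorization {𝕜 F X E : Type*} [NontriviallyNormedField 𝕜]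
    [NormedAddCommGroup F] [NormedSpace 𝕜 F] [CompleteSpace F]
    [NormedAddCommGroup X] [NormedSpace 𝕜 X] [CompleteSpace X]
    [NormedAddCommGroup E] [NormedSpace 𝕜 E] (Φ : F →L[𝕜] E) (j : X →L[𝕜] E)
    (hj : Function.Injective j) (h : ∀ u, ∃ x, j x = Φ u) :
    ∃ Ψ : F →L[𝕜] X, ∀ u, j (Ψ u) = Φ u := by
  choose g hg using h
  let f : F →ₗ[𝕜] X :=
    { toFun := g
      map_add' := fun u v => hj (by simp [hg])
      map_smul' := fun c u => hj (by simp [hg]) }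
  -- Closed graph theorem: limits are compared after applying `j`, where `j ∘ f = Φ` is continuous.
  refine ⟨ContinuousLinearMap.ofSeqClosedGraph (g := f) fun u x y hu hy => ?_, fun u => hg u⟩
  refine hj (tendsto_nhds_unique ((j.continuous.tendsto y).comp hy) ?_)
  have h1 : j (f x) = Φ x := hg x
  rw [h1]
  exact ((Φ.continuous.tendsto x).comp hu).congr fun n => (hg (u n)).symm

section Admissible

section Composition

variable {𝕜 U E : Type*} [RCLike 𝕜] [NormedAddCommGroup U] [NormedSpace 𝕜 U]
  [NormedAddCommGroup E] [NormedSpace 𝕜 E] {L : ℝ≥0 → E →L[𝕜] E}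

theorem continuous_semigroup_comp (hL : Continuous fun p : ℝ≥0 × E => L p.1 p.2) (B : U →L[𝕜] E) :
    Continuous fun p : ℝ × U => ((L p.1.toNNReal).comp B) p.2 :=
  hL.comp ((continuous_real_toNNReal.comp continuous_fst).prodMk (B.continuous.comp continuous_snd))

theorem exists_norm_semigroup_comp_le
    (hbd : ∀ σ, ∃ M : ℝ, 0 ≤ M ∧ ∀ t ≤ σ, ‖L t‖ ≤ M) (B : U →L[𝕜] E) (σ : ℝ) :
    ∃ M : ℝ, ∀ r ≤ σ, ‖(L r.toNNReal).comp B‖ ≤ M := by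
  obtain ⟨M, hM0, hM⟩ := hbd σ.toNNReal
  refine ⟨M * ‖B‖, fun r hr => (ContinuousLinearMap.opNorm_comp_le _ _).trans ?_⟩
  gcongr
  exact hM _ (Real.toNNReal_le_toNNReal hr)

theorem intervalIntegrable_semigroup (hL : Continuous fun p : ℝ≥0 × E => L p.1 p.2)
    (hbd : ∀ σ, ∃ M : ℝ, 0 ≤ M ∧ ∀ t ≤ σ, ‖L t‖ ≤ M) (B : U →L[𝕜] E) {w : ℝ → U}
    (hw : MemLp w 2 volume) {a b : ℝ} (hab : a ≤ b) :
    IntervalIntegrable (fun r => L r.toNNReal (B (w r))) volume a b := by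
  obtain ⟨M, hM⟩ := exists_norm_semigroup_comp_le hbd B b
  rw [intervalIntegrable_iff_integrableOn_Ioo_of_le hab]
  exact integrableOn_kernel (continuous_semigroup_comp hL B) (fun s hs => hM s hs.2.le)
    (hw.restrict _)

end Composition

variable {𝕜 X U E : Type*} [RCLike 𝕜] [NormedAddCommGroup X] [NormedSpace 𝕜 X]
  [NormedAddCommGroup U] [NormedSpace 𝕜 U]
  [NormedAddCommGroup E] [NormedSpace 𝕜 E] [NormedSpace ℝ E]
  {j : X →L[𝕜] E} {S : ℝ≥0 → X →L[𝕜] X} {L : ℝ≥0 → E →L[𝕜] E} {B : U →L[𝕜] E}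

/-- The range of the input map over `(0, σ)` lies in `X`; the property propagates to sums of
times. -/
theorem mem_range_integral_add [CompleteSpace E]
    (hL : Continuous fun p : ℝ≥0 × E => L p.1 p.2)
    (hbd : ∀ σ, ∃ M : ℝ, 0 ≤ M ∧ ∀ t ≤ σ, ‖L t‖ ≤ M)
    (hadd : ∀ s t ξ, L (s + t) ξ = L s (L t ξ)) (hj : ∀ t x, L t (j x) = j (S t x)) {σ τ : ℝ}
    (hσ : 0 ≤ σ) (hτ : 0 ≤ τ)
    (h1 : ∀ w : ℝ → U, MemLp w 2 volume → ∃ x, j x = ∫ r in (0 : ℝ)..σ, L r.toNNReal (B (w r)))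
    (h2 : ∀ w : ℝ → U, MemLp w 2 volume → ∃ x, j x = ∫ r in (0 : ℝ)..τ, L r.toNNReal (B (w r)))
    (w : ℝ → U) (hw : MemLp w 2 volume) :
    ∃ x, j x = ∫ r in (0 : ℝ)..(σ + τ), L r.toNNReal (B (w r)) := by
  have hw' : MemLp (fun s => w (s + σ)) 2 volume :=
    hw.comp_measurePreserving (measurePreserving_add_right volume σ)
  obtain ⟨x, hx⟩ := h1 w hw
  obtain ⟨y, hy⟩ := h2 _ hw'
  -- Split at `σ` and shift the second piece: `L (σ + r) = L σ ∘ L r`, and `L σ` maps the range of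
  -- `j` into itself.
  refine ⟨x + S σ.toNNReal y, ?_⟩
  have hI := fun {a b : ℝ} (hab : a ≤ b) => intervalIntegrable_semigroup hL hbd B hw hab
  rw [← intervalIntegral.integral_add_adjacent_intervals (hI hσ) (hI (le_add_of_nonneg_right hτ)),
    map_add, hx, ← hj, hy, ← ContinuousLinearMap.intervalIntegral_comp_comm _
      (intervalIntegrable_semigroup hL hbd B hw' hτ)]
  congr 1
  have h3 := intervalIntegral.integral_comp_add_right (a := 0) (b := τ)
    (fun r => L r.toNNReal (B (w r))) σ
  rw [zero_add, add_comm τ σ] at h3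
  rw [← h3]
  refine intervalIntegral.integral_congr fun r hr => ?_
  rw [uIcc_of_le hτ] at hr
  rw [← hadd, ← Real.toNNReal_add hσ hr.1, add_comm σ r]

theorem exists_integral_semigroup [SMulCommClass ℝ 𝕜 E]
    (hL : Continuous fun p : ℝ≥0 × E => L p.1 p.2)
    (hbd : ∀ σ, ∃ M : ℝ, 0 ≤ M ∧ ∀ t ≤ σ, ‖L t‖ ≤ M) (B : U →L[𝕜] E) {t T : ℝ} (htT : t ≤ T) :
    ∃ Φ : L2 0 T U →L[𝕜] E, ∀ u, Φ u = ∫ s in Ioo 0 t, L (t - s).toNNReal (B (u s)) := by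
  obtain ⟨M, hM⟩ := exists_norm_semigroup_comp_le hbd B t
  exact exists_integral_kernel (K := fun s => (L (t - s).toNNReal).comp B)
    ((continuous_semigroup_comp hL B).comp
      ((continuous_const.sub continuous_fst).prodMk continuous_snd))
    (fun s hs => hM (t - s) (by linarith [hs.1]))
    (Measure.restrict_mono (Ioo_subset_Ioo_right htT) le_rfl)

/-- Restarts the evolution at `b`: `L (t - s) = L (t - b) ∘ L (b - s)`, and the bounded operator `L
(t - b)` leaves the integral. -/
theorem integral_semigroup_split [CompleteSpace E]
    (hL : Continuous fun p : ℝ≥0 × E => L p.1 p.2)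
    (hbd : ∀ σ, ∃ M : ℝ, 0 ≤ M ∧ ∀ t ≤ σ, ‖L t‖ ≤ M)
    (hadd : ∀ s t ξ, L (s + t) ξ = L s (L t ξ)) {a b t T : ℝ} (hab : a ≤ b) (hbt : b ≤ t)
    (htT : t ≤ T) {u : ℝ → U} (hu : MemLp u 2 (volume.restrict (Ioo a T))) :
    ∫ s in Ioo a t, L (t - s).toNNReal (B (u s)) =
      L (t - b).toNNReal (∫ s in Ioo a b, L (b - s).toNNReal (B (u s))) +
        ∫ s in Ioo b t, L (t - s).toNNReal (B (u s)) := by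
  have hI : ∀ t ≤ T, IntegrableOn (fun s => L (t - s).toNNReal (B (u s))) (Ioo a t) := by
    intro t ht
    obtain ⟨M, hM⟩ := exists_norm_semigroup_comp_le hbd B (t - a)
    refine integrableOn_kernel (K := fun s => (L (t - s).toNNReal).comp B) ?_
      (fun s hs => hM _ (by linarith [hs.1]))
      (hu.mono_measure (Measure.restrict_mono (Ioo_subset_Ioo_right ht) le_rfl))
    exact (continuous_semigroup_comp hL B).comp
      ((continuous_const.sub continuous_fst).prodMk continuous_snd)
  have hIt := (intervalIntegrable_iff_integrableOn_Ioo_of_le (hab.trans hbt)).2 (hI t htT)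
  simp only [← integral_Ioc_eq_integral_Ioo]
  rw [← intervalIntegral.integral_of_le hab, ← intervalIntegral.integral_of_le hbt,
    ← intervalIntegral.integral_of_le (hab.trans hbt),
    ← intervalIntegral.integral_add_adjacent_intervals
      (hIt.mono_set (by
        rw [uIcc_of_le hab, uIcc_of_le (hab.trans hbt)]; exact Icc_subset_Icc_right hbt))
      (hIt.mono_set (by
        rw [uIcc_of_le hbt, uIcc_of_le (hab.trans hbt)]; exact Icc_subset_Icc_left hab)),
    ← ContinuousLinearMap.intervalIntegral_comp_comm _
      ((intervalIntegrable_iff_integrableOn_Ioo_of_le hab).2 (hI b (hbt.trans htT)))]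
  congr 1
  refine intervalIntegral.integral_congr fun s hs => ?_
  rw [uIcc_of_le hab] at hs
  rw [← hadd, ← Real.toNNReal_add (sub_nonneg.2 hbt) (sub_nonneg.2 hs.2), sub_add_sub_cancel]

/-- If the input map is admissible at one time, then it is continuous in time with values in `X`. -/
theorem exists_continuous_input [CompleteSpace X] [CompleteSpace U] [CompleteSpace E]
    (hL : Continuous fun p : ℝ≥0 × E => L p.1 p.2)
    (hbd : ∀ σ, ∃ M : ℝ, 0 ≤ M ∧ ∀ t ≤ σ, ‖L t‖ ≤ M)
    (hadd : ∀ s t ξ, L (s + t) ξ = L s (L t ξ)) (hj : ∀ t x, L t (j x) = j (S t x))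
    (hinj : Function.Injective j) {τ : ℝ} (hτ : 0 < τ)
    (hadm : ∀ u : L2 0 τ U, ∃ x, j x = ∫ s in Ioo 0 τ, L (τ - s).toNNReal (B (u s)))
    {T : ℝ} (u : L2 0 T U) :
    ∃ z : ℝ → X, Continuous z ∧ ∀ t ∈ Icc 0 T,
      j (z t) = ∫ s in Ioo 0 t, L (t - s).toNNReal (B (u s)) := by
  -- Time reversal turns the convolution into an integral against the fixed kernel `L r`, so that
  -- `t` will enter only through a translation of the control.
  have hτ1 : ∀ w : ℝ → U, MemLp w 2 volume →
      ∃ x, j x = ∫ r in (0 : ℝ)..τ, L r.toNNReal (B (w r)) := by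
    intro w hw
    have hw' : MemLp (fun s => w (τ - s)) 2 (volume.restrict (Ioo 0 τ)) :=
      (hw.comp_measurePreserving (Measure.measurePreserving_sub_left volume τ)).restrict (Ioo 0 τ)
    obtain ⟨x, hx⟩ := hadm (hw'.toLp _)
    refine ⟨x, ?_⟩
    have h3 := intervalIntegral.integral_comp_sub_left (a := 0) (b := τ)
      (fun r => L r.toNNReal (B (w r))) τ
    rw [sub_self, sub_zero] at h3
    rw [hx, ← h3, intervalIntegral.integral_of_le hτ.le, integral_Ioc_eq_integral_Ioo]
    refine integral_congr_ae ?_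
    filter_upwards [hw'.coeFn_toLp] with s hs
    rw [hs]
  have hn : ∀ n : ℕ, ∀ w : ℝ → U, MemLp w 2 volume →
      ∃ x, j x = ∫ r in (0 : ℝ)..(n * τ), L r.toNNReal (B (w r)) := by
    intro n
    induction n with
    | zero => exact fun w _ => ⟨0, by simp⟩
    | succ n ih =>
      rw [Nat.cast_succ, add_one_mul]
      exact mem_range_integral_add hL hbd hadd hj (by positivity) hτ.le ih hτ1
  obtain ⟨n, hnT⟩ := exists_nat_ge (T / τ)
  rw [div_le_iff₀ hτ] at hnT
  set σ : ℝ := n * τ with hσ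
  have hσ0 : 0 ≤ σ := by positivity
  obtain ⟨M, hM⟩ := exists_norm_semigroup_comp_le hbd B σ
  obtain ⟨Φ, hΦ⟩ := exists_integral_kernel (continuous_semigroup_comp hL B) (a := 0) (b := σ)
    (fun s hs => hM s hs.2.le) (Measure.restrict_le_self (μ := volume))
  obtain ⟨Ψ, hΨ⟩ := exists_factorization Φ j hinj fun w => by
    obtain ⟨x, hx⟩ := hn n w (Lp.memLp w)
    refine ⟨x, ?_⟩
    rw [hx, hΦ, intervalIntegral.integral_of_le hσ0, integral_Ioc_eq_integral_Ioo]
    rfl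
  set g : ℝ → U := indicator (Ioo 0 T) u with hg
  have hgL : MemLp g 2 volume := (memLp_indicator_iff_restrict measurableSet_Ioo).2 (Lp.memLp u)
  have hgn : MemLp (fun s => g (-s)) 2 volume :=
    hgL.comp_measurePreserving (Measure.measurePreserving_neg volume)
  have : Fact ((2 : ℝ≥0∞) ≠ ∞) := ⟨by norm_num⟩
  -- Here `g` is `u` extended by zero, and the translate of `s ↦ g (-s)` is `r ↦ g (t - r)`. Its
  -- dependence on `t` is continuous in `L²(ℝ)`, since the exponent is finite.
  refine ⟨fun t => Ψ (DomAddAct.mk (-t) +ᵥ hgn.toLp _), ?_, fun t ht => ?_⟩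
  · refine Ψ.continuous.comp ?_
    exact (DomAddAct.continuous_mk.comp continuous_neg).vadd continuous_const
  · have ht' : t ≤ σ := ht.2.trans hnT
    have hae : (DomAddAct.mk (-t) +ᵥ hgn.toLp _ : Lp U 2 (volume : Measure ℝ)) =ᵐ[volume]
        fun r => g (t - r) := by
      rw [DomAddAct.mk_vadd_toLp]
      refine (MemLp.coeFn_toLp _).trans (Eventually.of_forall fun r => ?_)
      simp [sub_eq_add_neg, add_comm]
    have h3 := intervalIntegral.integral_comp_sub_left (a := 0) (b := t)
      (fun r => L r.toNNReal (B (g (t - r)))) t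
    rw [sub_self, sub_zero] at h3
    rw [hΨ, hΦ]
    have h4 : ∫ r in Ioo 0 σ, ((L r.toNNReal).comp B)
        ((DomAddAct.mk (-t) +ᵥ hgn.toLp _ : Lp U 2 (volume : Measure ℝ)) r) =
        ∫ r in Ioo 0 σ, L r.toNNReal (B (g (t - r))) := by
      refine integral_congr_ae ?_
      filter_upwards [ae_restrict_of_ae hae] with r hr
      rw [hr]
      rfl
    -- For `r ≥ t` the argument `t - r` is not positive, so `g` vanishes there.
    have h5 : ∫ r in Ioo 0 σ, L r.toNNReal (B (g (t - r))) =
        ∫ r in Ioo 0 t, L r.toNNReal (B (g (t - r))) := by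
      refine (setIntegral_eq_of_subset_of_forall_sdiff_eq_zero measurableSet_Ioo
        (Ioo_subset_Ioo_right ht') fun r hr => ?_)
      have : t - r ∉ Ioo 0 T := fun h => hr.2 ⟨hr.1.1, by linarith [h.1]⟩
      simp [hg, this]
    rw [h4, h5, ← integral_Ioc_eq_integral_Ioo, ← intervalIntegral.integral_of_le ht.1, ← h3,
      intervalIntegral.integral_of_le ht.1, integral_Ioc_eq_integral_Ioo]
    refine setIntegral_congr_fun measurableSet_Ioo fun s hs => ?_
    have : s ∈ Ioo 0 T := ⟨hs.1, hs.2.trans_le ht.2⟩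
    simp [hg, this]

end Admissible

/-! ### Hilbert space projection and the singular weight. -/

/-- Projection onto an affine subspace `Φ u = e` of a Hilbert space, with Pythagoras' identity. -/
theorem exists_nearest_of_affine {𝕜 H E : Type*} [RCLike 𝕜] [NormedAddCommGroup H]
    [InnerProductSpace 𝕜 H] [CompleteSpace H] [NormedAddCommGroup E] [NormedSpace 𝕜 E]
    (Φ : H →L[𝕜] E) {e : E} (d : H) (h : ∃ u, Φ u = e) :
    ∃ u, Φ u = e ∧ ∀ v, Φ v = e → ‖v - d‖ ^ 2 = ‖u - d‖ ^ 2 + ‖v - u‖ ^ 2 := by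
  obtain ⟨u₁, hu₁⟩ := h
  set N : Submodule 𝕜 H := LinearMap.ker (Φ : H →ₗ[𝕜] E)
  have hN : ∀ w, w ∈ N ↔ Φ w = 0 := fun w => LinearMap.mem_ker
  have : CompleteSpace N := Φ.isClosed_ker.completeSpace_coe
  set u : H := u₁ + N.starProjection (d - u₁) with hu
  have hΦ : Φ u = e := by
    rw [hu, map_add, hu₁, (hN _).1 (N.starProjection_apply_mem _), add_zero]
  refine ⟨u, hΦ, fun v hv => ?_⟩
  have hvN : v - u ∈ N := by
    rw [hN, map_sub, hv, hΦ, sub_self]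
  have hort : ⟪u - d, v - u⟫_𝕜 = 0 := by
    have h1 := N.starProjection_inner_eq_zero (d - u₁) (v - u) hvN
    have h2 : u - d = -(d - u₁ - N.starProjection (d - u₁)) := by rw [hu]; abel
    rw [h2, inner_neg_left, h1, neg_zero]
  have h3 := norm_add_sq_eq_norm_sq_add_norm_sq_of_inner_eq_zero (u - d) (v - u) hort
  rw [show v - d = u - d + (v - u) by abel]
  simpa [pow_two] using h3

/-- The weight `1 / (s - t₀)` makes the integral diverge unless `y(t₀) = xd`. -/
theorem lintegral_weight_eq_top {X : Type*} [NormedAddCommGroup X] {t₀ T : ℝ} (hT : t₀ < T)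
    {xd : X} {y : ℝ → X} (hy : ContinuousOn y (Icc t₀ T)) (hne : y t₀ ≠ xd) :
    ∫⁻ s in Ioo t₀ T, ENNReal.ofReal (1 / (s - t₀) * ‖y s - xd‖) = ∞ := by
  have hpos : 0 < ‖y t₀ - xd‖ := norm_pos_iff.2 (sub_ne_zero.2 hne)
  -- By continuity `‖y s - xd‖ > δ` just after `t₀`, so the integrand dominates `δ / (s - t₀)`.
  set δ := ‖y t₀ - xd‖ / 2 with hδ
  have hδ0 : 0 < δ := half_pos hpos
  have hev : ∀ᶠ s in 𝓝[Icc t₀ T] t₀, δ < ‖y s - xd‖ :=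
    (((hy t₀ (left_mem_Icc.2 hT.le)).sub continuousWithinAt_const).norm).eventually_const_lt
      (half_lt_self hpos)
  rw [nhdsWithin_Icc_eq_nhdsGE hT] at hev
  obtain ⟨c, hc, hcs⟩ := mem_nhdsGE_iff_exists_Ico_subset.1 hev
  set b := min c T with hb
  have htb : t₀ < b := lt_min hc hT
  by_contra hfin
  have hle : ∫⁻ s in Ioo t₀ b, ENNReal.ofReal δ * ENNReal.ofReal ((s - t₀)⁻¹) ≤
      ∫⁻ s in Ioo t₀ T, ENNReal.ofReal (1 / (s - t₀) * ‖y s - xd‖) := by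
    refine (setLIntegral_mono' measurableSet_Ioo fun s hs => ?_).trans
      (lintegral_mono_set (Ioo_subset_Ioo_right (min_le_right c T)))
    rw [← ENNReal.ofReal_mul hδ0.le]
    refine ENNReal.ofReal_le_ofReal ?_
    have h1 : 0 < s - t₀ := sub_pos.2 hs.1
    have h2 : δ < ‖y s - xd‖ := hcs ⟨hs.1.le, hs.2.trans_le (min_le_left _ _)⟩
    rw [one_div, mul_comm]
    gcongr
  rw [lintegral_const_mul' _ _ ENNReal.ofReal_ne_top] at hle
  have hlt : ∫⁻ s in Ioo t₀ b, ENNReal.ofReal ((s - t₀)⁻¹) < ∞ := by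
    by_contra htop
    rw [not_lt_top_iff] at htop
    rw [htop, ENNReal.mul_top (by simpa using hδ0)] at hle
    exact hfin (top_le_iff.1 hle)
  have hint : IntegrableOn (fun s => (s - t₀)⁻¹) (Ioo t₀ b) := by
    refine ⟨by fun_prop, ?_⟩
    rw [hasFiniteIntegral_iff_norm]
    refine (setLIntegral_congr_fun measurableSet_Ioo fun s hs => ?_).trans_lt hlt
    have h1 : 0 < s - t₀ := sub_pos.2 hs.1
    rw [Real.norm_of_nonneg (by positivity)]
  have := intervalIntegrable_sub_inv_iff.1
    ((intervalIntegrable_iff_integrableOn_Ioo_of_le htb.le).2 hint)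
  rcases this with h | h
  · exact htb.ne h
  · exact h left_mem_uIcc

/-! ### Solutions, reachability and holdable states. -/

namespace ControlSystem

variable {𝕜 X U : Type*} [RCLike 𝕜] [NormedAddCommGroup X] [InnerProductSpace 𝕜 X]
  [NormedAddCommGroup U] [InnerProductSpace 𝕜 U] [CompleteSpace X]
  (sys : ControlSystem 𝕜 X U)

/-- The embedding `X → X₋₁` as a bounded operator. -/
def embedL (A : X →ₗ.[𝕜] X) : BoundedOperator 𝕜 X (Extrapolation A) :=
  LinearMap.mkContinuous
    { toFun := embed A
      map_add' := fun x y => by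
        ext φ
        exact inner_add_right _ x y
      map_smul' := fun c x => by
        ext φ
        exact inner_smul_right _ x c } 1 fun x => by
    rw [one_mul]
    refine ContinuousLinearMap.opNorm_le_bound _ (norm_nonneg x) fun φ => ?_
    rw [mul_comm]
    refine (norm_inner_le_norm (φ : X × X).1 x).trans ?_
    gcongr
    exact norm_fst_le (φ : X × X)

theorem extendedSemigroupL_locally_bounded (σ : ℝ≥0) :
    ∃ M : ℝ, 0 ≤ M ∧ ∀ t ≤ σ, ‖sys.extendedSemigroupL t‖ ≤ M := by
  obtain ⟨M, hM0, hM⟩ := sys.S.exists_norm_le σ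
  exact ⟨M, hM0, fun t ht => (LinearMap.mkContinuous_norm_le _ (norm_nonneg _) _).trans (hM t ht)⟩

/-- An admissible control system has a solution for every control and every initial state. -/
theorem exists_isSolution [CompleteSpace U] (hB : sys.IsAdmissible) {T : ℝ} (x₀ : X)
    (u : L2 0 T U) : ∃ x, sys.IsSolution 0 T x₀ u x := by
  obtain ⟨τ, hτ, hadm⟩ := hB
  obtain ⟨z, hz, hzt⟩ := exists_continuous_input (E := Extrapolation sys.A) (j := embedL sys.A)
    (S := sys.S.toFun) (L := sys.extendedSemigroupL) (B := sys.B)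
    sys.continuous_extendedSemigroup_uncurry sys.extendedSemigroupL_locally_bounded
    sys.extendedSemigroup_add sys.extendedSemigroup_embed sys.embed_injective hτ hadm u
  refine ⟨fun t => sys.S.toFun (t - 0).toNNReal x₀ + z t, ?_, fun t ht => ?_⟩
  · have h1 : Continuous fun t : ℝ => sys.S.toFun (t - 0).toNNReal x₀ :=
      (sys.S.continuous_orbit x₀).comp (by fun_prop)
    exact (h1.add hz).continuousOn
  · have h2 : embed sys.A (z t) = sys.inputMap 0 t u := hzt t ht
    rw [← h2]
    exact map_add (embedL sys.A) _ _

theorem inputMap_congr {a t : ℝ} {u v : ℝ → U} (h : u =ᵐ[volume.restrict (Ioo a t)] v) :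
    sys.inputMap a t u = sys.inputMap a t v := by
  refine integral_congr_ae ?_
  filter_upwards [h] with s hs
  rw [hs]

theorem inputMap_split {a b t T : ℝ} (hab : a ≤ b) (hbt : b ≤ t) (htT : t ≤ T) (u : L2 a T U) :
    sys.inputMap a t u =
      sys.extendedSemigroup (t - b).toNNReal (sys.inputMap a b u) + sys.inputMap b t u := by
  have h := integral_semigroup_split (E := Extrapolation sys.A) (L := sys.extendedSemigroupL)
    (B := sys.B) sys.continuous_extendedSemigroup_uncurry sys.extendedSemigroupL_locally_bounded
    sys.extendedSemigroup_add hab hbt htT (Lp.memLp u)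
  simp only [extendedSemigroupL_apply] at h
  exact h

/-- The input map at a fixed time is a bounded operator on `L²`. -/
theorem exists_inputMap_clm {t T : ℝ} (htT : t ≤ T) :
    ∃ Φ : BoundedOperator 𝕜 (L2 0 T U) (Extrapolation sys.A), ∀ u, Φ u = sys.inputMap 0 t u := by
  obtain ⟨Φ, hΦ⟩ := exists_integral_semigroup (E := Extrapolation sys.A)
    (L := sys.extendedSemigroupL) sys.continuous_extendedSemigroup_uncurry
    sys.extendedSemigroupL_locally_bounded sys.B htT
  exact ⟨Φ, hΦ⟩

variable {sys} {t₀ T : ℝ} {x₀ xd : X} {ud : U}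

/-- The initial state can be steered to every target at time `t₀` by controls on `(0, T)`. -/
theorem IsExactlyControllable.exists_inputMap (hctrl : sys.IsExactlyControllable t₀)
    (ht₀ : 0 < t₀) (hT : t₀ ≤ T) (x₀ x₁ : X) : ∃ u : L2 0 T U, embed sys.A x₁ =
      embed sys.A (sys.S.toFun (t₀ - 0).toNNReal x₀) + sys.inputMap 0 t₀ u := by
  obtain ⟨C, -, hC⟩ := hctrl
  obtain ⟨u, x, hx, rfl, -⟩ := hC x₀ x₁
  have hu : MemLp (indicator (Ioo 0 t₀) u) 2 (volume : Measure ℝ) :=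
    (memLp_indicator_iff_restrict measurableSet_Ioo).2 (Lp.memLp u)
  have hu' := hu.restrict (Ioo 0 T)
  refine ⟨hu'.toLp _, ?_⟩
  rw [hx.2 t₀ (right_mem_Icc.2 ht₀.le)]
  congr 1
  refine sys.inputMap_congr ?_
  filter_upwards [ae_restrict_of_ae_restrict_of_subset (Ioo_subset_Ioo_right hT) hu'.coeFn_toLp,
    ae_restrict_mem measurableSet_Ioo] with s hs hs'
  rw [hs, indicator_of_mem hs']

/-- Once a holdable state is reached, the constant control keeps the state there. -/
theorem IsHoldable.eq_of_isSolution (hhold : sys.IsHoldable t₀ T xd ud) (ht₀ : 0 ≤ t₀)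
    {u : L2 0 T U} {x : ℝ → X} (hx : sys.IsSolution 0 T x₀ u x) (hxt : x t₀ = xd)
    (hu : ∀ᵐ s ∂volume.restrict (Ioo t₀ T), u s = ud) {t : ℝ} (ht : t ∈ Icc t₀ T) :
    x t = xd := by
  refine sys.embed_injective ?_
  have hh := hhold.2 t ht
  have h0 := hx.2 t₀ ⟨ht₀, ht.1.trans ht.2⟩
  -- After restarting at `t₀` from the state `xd`, the equation for `x t` has the same right-hand
  -- side as the one in `hhold`.
  rw [hx.2 t ⟨ht₀.trans ht.1, ht.2⟩, sys.inputMap_split ht₀ ht.1 ht.2 u]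
  have hS : sys.S.toFun (t - 0).toNNReal x₀ =
      sys.S.toFun (t - t₀).toNNReal (sys.S.toFun (t₀ - 0).toNNReal x₀) := by
    rw [← sys.S.toFun_add_apply, ← Real.toNNReal_add (sub_nonneg.2 ht.1) (by simpa using ht₀),
      sub_add_sub_cancel]
  have hI : sys.inputMap t₀ t u =
      sys.inputMap t₀ t (Lp.const 2 (volume.restrict (Ioo t₀ T)) ud) := by
    have hsub : Ioo t₀ t ⊆ Ioo t₀ T := Ioo_subset_Ioo_right ht.2
    refine sys.inputMap_congr ?_
    filter_upwards [ae_restrict_of_ae_restrict_of_subset hsub hu,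
      ae_restrict_of_ae_restrict_of_subset hsub (Lp.coeFn_const 2 _ ud)] with s h1 h2
    rw [h1, h2]
    rfl
  have hadd : sys.extendedSemigroup (t - t₀).toNNReal
      (embed sys.A (sys.S.toFun (t₀ - 0).toNNReal x₀) + sys.inputMap 0 t₀ u) =
      sys.extendedSemigroup (t - t₀).toNNReal (embed sys.A (sys.S.toFun (t₀ - 0).toNNReal x₀)) +
        sys.extendedSemigroup (t - t₀).toNNReal (sys.inputMap 0 t₀ u) := rfl
  rw [← h0, hxt, extendedSemigroup_embed, extendedSemigroup_embed, ← hS] at hadd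
  rw [← add_assoc, ← hadd, hI]
  exact hh.symm

end ControlSystem

/-- The constant continuation of a control after time `t₀` brings it closer to the constant. -/
theorem exists_constant_continuation {U : Type*} [NormedAddCommGroup U] (t₀ T : ℝ) (ud : U)
    (u : L2 0 T U) : ∃ v : L2 0 T U,
      (∀ᵐ s ∂volume.restrict (Ioo 0 T), s ≤ t₀ → v s = u s) ∧
      (∀ᵐ s ∂volume.restrict (Ioo 0 T), t₀ < s → v s = ud) ∧
      ‖v - Lp.const 2 _ ud‖ ≤ ‖u - Lp.const 2 _ ud‖ := by
  -- Cut the difference `u - ud` off after `t₀`, then add `ud` back.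
  have hw : MemLp (indicator (Iic t₀) (u - Lp.const 2 _ ud : L2 0 T U)) 2
      (volume.restrict (Ioo 0 T)) := (Lp.memLp _).indicator measurableSet_Iic
  have hsub := Lp.coeFn_sub u (Lp.const 2 _ ud)
  have hconst := Lp.coeFn_const 2 (volume.restrict (Ioo 0 T)) ud
  refine ⟨hw.toLp _ + Lp.const 2 _ ud, ?_, ?_, ?_⟩
  · filter_upwards [hw.coeFn_toLp, hsub, hconst, Lp.coeFn_add (hw.toLp _) (Lp.const 2 _ ud)] with
      s h1 h2 h3 h4 hs
    rw [h4, Pi.add_apply, h1, indicator_of_mem (mem_Iic.2 hs), h2, Pi.sub_apply, sub_add_cancel]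
  · filter_upwards [hw.coeFn_toLp, hconst, Lp.coeFn_add (hw.toLp _) (Lp.const 2 _ ud)] with
      s h1 h3 h4 hs
    rw [h4, Pi.add_apply, h1, indicator_of_notMem (by simpa using hs), h3, zero_add]
    rfl
  · rw [add_sub_cancel_right]
    refine Lp.norm_le_norm_of_ae_le ?_
    filter_upwards [hw.coeFn_toLp] with s h1
    rw [h1]
    exact norm_indicator_le_norm_self _ _

end Turnpike

end

/-! ### The optimal pair and its uniqueness. -/

theorem mainTheorem6 {𝕜 X U : Type*} [RCLike 𝕜]
    [NormedAddCommGroup X] [InnerProductSpace 𝕜 X] [CompleteSpace X]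
    [NormedAddCommGroup U] [InnerProductSpace 𝕜 U] [CompleteSpace U]
    (sys : Turnpike.ControlSystem 𝕜 X U) (hB : sys.IsAdmissible)
    (t₀ T : ℝ) (ht₀ : 0 < t₀) (hT : t₀ < T)
    (hctrl : sys.IsExactlyControllable t₀)
    (x₀ xd : X) (ud : U) (hhold : sys.IsHoldable t₀ T xd ud)
    (γ : ℝ) (hγ : 0 < γ) :
    ∃ (u : Turnpike.L2 0 T U) (x : ℝ → X),
      Turnpike.IsOptimal sys t₀ T γ x₀ xd ud u x ∧
      (∀ t ∈ Set.Icc t₀ T, x t = xd) ∧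
      ∀ (v : Turnpike.L2 0 T U) (y : ℝ → X),
        Turnpike.IsOptimal sys t₀ T γ x₀ xd ud v y →
          v = u ∧ Set.EqOn y x (Set.Icc 0 T) := by
  open Turnpike ControlSystem in
  have htmem : t₀ ∈ Icc 0 T := ⟨ht₀.le, hT.le⟩
  obtain ⟨Φ, hΦ⟩ := sys.exists_inputMap_clm hT.le
  -- The target minus the free evolution, so that `Φ v = e` means that the state hits `xd` at `t₀`.
  set e : Extrapolation sys.A :=
    embed sys.A xd - embed sys.A (sys.S.toFun (t₀ - 0).toNNReal x₀)
  have hΦe : ∀ v, Φ v = e ↔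
      embed sys.A (sys.S.toFun (t₀ - 0).toNNReal x₀) + sys.inputMap 0 t₀ v = embed sys.A xd := by
    intro v
    rw [hΦ]
    exact eq_sub_iff_add_eq' (G := Extrapolation sys.A)
  have hreach : ∀ (v : L2 0 T U) (y : ℝ → X), sys.IsSolution 0 T x₀ v y →
      (Φ v = e ↔ y t₀ = xd) := by
    intro v y hy
    rw [hΦe, ← hy.2 t₀ htmem]
    exact sys.embed_injective.eq_iff
  obtain ⟨u, hu, hmin⟩ := exists_nearest_of_affine Φ (e := e) (Lp.const 2 _ ud) (by
    obtain ⟨v, hv⟩ := hctrl.exists_inputMap ht₀ hT.le x₀ xd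
    exact ⟨v, (hΦe v).2 hv.symm⟩)
  have hud : ∀ᵐ s ∂volume.restrict (Ioo t₀ T), u s = ud := by
    obtain ⟨v, hv1, hv2, hv3⟩ := exists_constant_continuation t₀ T ud u
    have hΦv : Φ v = e := by
      rw [← hu, hΦ, hΦ]
      refine sys.inputMap_congr ?_
      filter_upwards [ae_restrict_of_ae_restrict_of_subset (Ioo_subset_Ioo_right hT.le) hv1,
        ae_restrict_mem measurableSet_Ioo] with s hs hs'
      exact hs hs'.2.le
    have h1 := hmin v hΦv
    -- Pythagoras' identity leaves no room for a feasible `v ≠ u` that is as close to `ud` as `u`.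
    have h2 : ‖v - u‖ ^ 2 ≤ 0 := by
      have := pow_le_pow_left₀ (norm_nonneg _) hv3 2
      linarith
    have h3 : v = u := by
      rw [← sub_eq_zero, ← norm_eq_zero]
      exact pow_eq_zero_iff two_ne_zero |>.1 (le_antisymm h2 (by positivity))
    subst h3
    filter_upwards [ae_restrict_of_ae_restrict_of_subset (Ioo_subset_Ioo_left ht₀.le) hv2,
      ae_restrict_mem measurableSet_Ioo] with s hs hs'
    exact hs hs'.1
  obtain ⟨x, hx⟩ := sys.exists_isSolution hB x₀ u
  have hxd : ∀ t ∈ Icc t₀ T, x t = xd := fun t ht =>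
    hhold.eq_of_isSolution ht₀.le hx ((hreach u x hx).1 hu) hud ht
  have hcost : cost t₀ T γ xd ud u x =
      ENNReal.ofReal (1 / 2 * ‖u - Lp.const 2 _ ud‖ ^ 2) := by
    have : ∫⁻ s in Ioo t₀ T, ENNReal.ofReal (1 / (s - t₀) * ‖x s - xd‖) = 0 := by
      rw [setLIntegral_congr_fun measurableSet_Ioo (g := fun _ => 0) fun s hs => by
        simp [hxd s ⟨hs.1.le, hs.2.le⟩]]
      simp
    rw [cost, this, mul_zero, add_zero]
  have hfeas : ∀ (v : L2 0 T U) (y : ℝ → X), sys.IsSolution 0 T x₀ v y →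
      cost t₀ T γ xd ud v y ≠ ∞ → Φ v = e := by
    intro v y hy hfin
    rw [hreach v y hy]
    by_contra hne
    refine hfin ?_
    rw [cost, lintegral_weight_eq_top hT (hy.1.mono (Icc_subset_Icc_left ht₀.le)) hne,
      ENNReal.mul_top (by simpa using hγ), add_top]
  refine ⟨u, x, ⟨hx, fun v y hy => ?_⟩, hxd, fun v y hvy => ?_⟩
  · by_cases hfin : cost t₀ T γ xd ud v y = ∞
    · rw [hfin]
      exact le_top
    · have h1 := hmin v (hfeas v y hy hfin)
      rw [hcost]
      refine le_trans (ENNReal.ofReal_le_ofReal ?_) le_self_add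
      rw [h1]
      linarith [sq_nonneg ‖v - u‖]
  · have hle := hvy.2 u x hx
    rw [hcost] at hle
    -- An optimal competitor costs no more than `(u, x)`, hence has finite cost and is feasible.
    have h1 := hmin v (hfeas v y hvy.1 (ne_top_of_le_ne_top ENNReal.ofReal_ne_top hle))
    have h2 := (ENNReal.ofReal_le_ofReal_iff (by positivity)).1 (le_self_add.trans hle)
    have h3 : v = u := by
      rw [← sub_eq_zero, ← norm_eq_zero]
      exact pow_eq_zero_iff two_ne_zero |>.1 (le_antisymm (by linarith) (sq_nonneg _))
    refine ⟨h3, fun t ht => sys.embed_injective ?_⟩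
    rw [hvy.1.2 t ht, hx.2 t ht, h3]
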